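/- Let $T>0$, $\mu>0$, and let $H^1_{0,*}(0,T)=\{u\in H^1(0,T): u(0)=0\}$, $H^1_{*,0}(0,T)=\{v\in H^1(0,T): v(T)=0\}$, with $|u|_{H^1(0,T)}=\|\partial_t u\|_{L^2(0,T)}$. Let $$a(u,v)=-\int_0^T \partial_t u\,\partial_t v\,dt+\mu\int_0^T u\,v\,dt,\qquad u\in H^1_{0,*}(0,T),\ v\in H^1_{*,0}(0,T),$$ be the bilinear form of the weak formulation of $\partial_{tt}u+\mu u=f$ on $(0,T)$, $u(0)=\partial_t u(0)=0$, and let $\overline{\mathcal H}_T:H^1_{0,*}(0,T)\to H^1_{*,0}(0,T)$, $(\overline{\mathcal H}_T v)(t)=v(T)-v(t)$. Let $0=t_1=t_2=t_3<t_4<\dots<t_{N+1}=t_{N+2}=t_{N+3}=T$ be an open knot vector with simple interior knots and $N\ge 3$, let $h=\max_{1\le i\le N+2}|t_{i+1}-t_i|$ be its mesh-size, let $b_{i,2}$, $i=1,\dots,N$, be the quadratic B-splines on $[0,T]$ defined over these knots by the Cox--de Boor recursion (with values at $T$ taken as limits from the left), let $S^2_h=\operatorname{span}\{b_{i,2}\}_{i=1}^N$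 (the quadratic $C^1$ splines), and let $V^h_{0,*}=S^2_h\cap H^1_{0,*}(0,T)$. If $$h\le \frac{\pi^2}{\sqrt2\,(2+\sqrt\mu\,T)\,\mu T},$$ then for every $u_h\in V^h_{0,*}$ the supremum below is finite and $$\frac{2\pi^2}{(2+\sqrt\mu\,T)^2(\pi^2+4\mu T^2)}\,|u_h|_{H^1(0,T)}\le \sup_{0\ne v_h\in V^h_{0,*}}\frac{a(u_h,\overline{\mathcal H}_T v_h)}{|v_h|_{H^1(0,T)}}.$$ -/

import Mathlib

open MeasureTheory Set
open scoped ContDiff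

namespace IGA

noncomputable section

/-- `g` is a weak (distributional) derivative of `u` on the interval `(0,T)`:
`∫ u φ' = - ∫ g φ` for all `φ ∈ C_c^∞(0,T)`. -/
def IsWeakDeriv (T : ℝ) (u g : ℝ → ℝ) : Prop :=
  ∀ φ : ℝ → ℝ, ContDiff ℝ ∞ φ → HasCompactSupport φ → tsupport φ ⊆ Ioo 0 T →
    ∫ t in Ioo 0 T, u t * deriv φ t = -∫ t in Ioo 0 T, g t * φ t

/-- `g ∈ L²(0,T)` is a weak derivative of `u`. -/
def IsL2WeakDeriv (T : ℝ) (u g : ℝ → ℝ) : Prop :=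
  MemLp g 2 (volume.restrict (Ioo 0 T)) ∧ IsWeakDeriv T u g

theorem integrableOn_mul_test {T : ℝ} {g φ : ℝ → ℝ}
    (hg : IntegrableOn g (Ioo 0 T)) (hφ : Continuous φ) (hc : HasCompactSupport φ) :
    IntegrableOn (fun t => g t * φ t) (Ioo 0 T) := by
  obtain ⟨C, hC⟩ := hc.exists_bound_of_continuous hφ
  exact Integrable.mul_bdd (c := C) hg hφ.aestronglyMeasurable (Filter.Eventually.of_forall hC)

theorem integrableOn_of_memLp {T : ℝ} {g : ℝ → ℝ}
    (hg : MemLp g 2 (volume.restrict (Ioo 0 T))) : IntegrableOn g (Ioo 0 T) :=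
  hg.integrable (by norm_num)

theorem integrableOn_of_continuousOn {T : ℝ} {u : ℝ → ℝ}
    (hu : ContinuousOn u (Icc 0 T)) : IntegrableOn u (Ioo 0 T) :=
  hu.integrableOn_Icc.mono_set Ioo_subset_Icc_self

theorem IsL2WeakDeriv.add {T : ℝ} {u v g k : ℝ → ℝ}
    (hu : ContinuousOn u (Icc 0 T)) (hv : ContinuousOn v (Icc 0 T))
    (hg : IsL2WeakDeriv T u g) (hk : IsL2WeakDeriv T v k) :
    IsL2WeakDeriv T (u + v) (g + k) := by
  refine ⟨hg.1.add hk.1, fun φ h1 h2 h3 => ?_⟩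
  have hd : Continuous (deriv φ) := h1.continuous_deriv (by simp)
  simp only [Pi.add_apply, add_mul]
  rw [integral_add (integrableOn_mul_test (integrableOn_of_continuousOn hu) hd h2.deriv)
      (integrableOn_mul_test (integrableOn_of_continuousOn hv) hd h2.deriv),
    integral_add (integrableOn_mul_test (integrableOn_of_memLp hg.1) h1.continuous h2)
      (integrableOn_mul_test (integrableOn_of_memLp hk.1) h1.continuous h2),
    hg.2 φ h1 h2 h3, hk.2 φ h1 h2 h3]
  ring

theorem IsL2WeakDeriv.smul {T : ℝ} {u g : ℝ → ℝ} (c : ℝ) (hg : IsL2WeakDeriv T u g) :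
    IsL2WeakDeriv T (c • u) (c • g) := by
  refine ⟨hg.1.const_smul c, fun φ h1 h2 h3 => ?_⟩
  simp only [Pi.smul_apply, smul_eq_mul, mul_assoc]
  rw [integral_const_mul, integral_const_mul, hg.2 φ h1 h2 h3]
  ring

theorem isL2WeakDeriv_const (T c : ℝ) : IsL2WeakDeriv T (fun _ => c) 0 := by
  refine ⟨MemLp.zero, fun φ h1 h2 h3 => ?_⟩
  have hd : Continuous (deriv φ) := h1.continuous_deriv (by simp)
  have h0 : ∀ x, x ∉ Ioo 0 T → φ x = 0 := fun x hx => by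
    by_contra h
    exact hx (h3 (subset_tsupport φ h))
  rw [integral_const_mul]
  rcases le_or_gt T 0 with hT | hT
  · simp [Ioo_eq_empty (not_lt.mpr hT)]
  · have h4 : ∫ t in (0 : ℝ)..T, deriv φ t = φ T - φ 0 :=
      intervalIntegral.integral_deriv_eq_sub
        (fun x _ => (h1.differentiable (by simp)).differentiableAt) (hd.intervalIntegrable _ _)
    rw [intervalIntegral.integral_of_le hT.le, integral_Ioc_eq_integral_Ioo,
      h0 T (by simp), h0 0 (by simp)] at h4
    rw [h4]
    simp

/-- The Sobolev space `H¹(0,T)`; its elements are represented by their continuous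
representatives on `[0,T]` (values outside `[0,T]` are never used). -/
def H1 (T : ℝ) : Submodule ℝ (ℝ → ℝ) where
  carrier := {u | ContinuousOn u (Icc 0 T) ∧ ∃ g, IsL2WeakDeriv T u g}
  add_mem' := by
    rintro u v ⟨hu, g, hg⟩ ⟨hv, k, hk⟩
    exact ⟨hu.add hv, g + k, hg.add hu hv hk⟩
  zero_mem' := ⟨continuousOn_const, 0, isL2WeakDeriv_const T 0⟩
  smul_mem' := by
    rintro c u ⟨hu, g, hg⟩
    exact ⟨hu.const_smul c, c • g, hg.smul c⟩

/-- `H¹_{0,*}(0,T)`: functions of `H¹(0,T)` that vanish at `0`. -/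
def H1ZeroLeft (T : ℝ) : Submodule ℝ (ℝ → ℝ) :=
  H1 T ⊓ LinearMap.ker (LinearMap.proj (0 : ℝ) : (ℝ → ℝ) →ₗ[ℝ] ℝ)

/-- `H¹_{*,0}(0,T)`: functions of `H¹(0,T)` that vanish at `T`. -/
def H1ZeroRight (T : ℝ) : Submodule ℝ (ℝ → ℝ) :=
  H1 T ⊓ LinearMap.ker (LinearMap.proj T : (ℝ → ℝ) →ₗ[ℝ] ℝ)

open Classical in
/-- The weak derivative `∂ₜu ∈ L²(0,T)` (unique up to null sets) of `u ∈ H¹(0,T)`. -/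
def weakDeriv (T : ℝ) (u : ℝ → ℝ) : ℝ → ℝ :=
  if h : ∃ g, IsL2WeakDeriv T u g then h.choose else 0

/-- The seminorm `|u|_{H¹(0,T)} = ‖∂ₜu‖_{L²(0,T)}`. -/
def h1Seminorm (T : ℝ) (u : ℝ → ℝ) : ℝ :=
  Real.sqrt (∫ t in Ioo 0 T, weakDeriv T u t ^ 2)

/-- The form `a(u,v) = -⟨∂ₜu, ∂ₜv⟩ + μ ⟨u, v⟩`, with the inner products of `L²(0,T)`,
for `u ∈ H¹_{0,*}(0,T)` and `v ∈ H¹_{*,0}(0,T)`. -/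
def bilinForm (T μ : ℝ) (u : H1ZeroLeft T) (v : H1ZeroRight T) : ℝ :=
  -(∫ t in Ioo 0 T, weakDeriv T u t * weakDeriv T v t) +
    μ * ∫ t in Ioo 0 T, (u : ℝ → ℝ) t * (v : ℝ → ℝ) t

/-- The map `H̄_T : H¹_{0,*}(0,T) → H¹_{*,0}(0,T)`, `u ↦ u(T) - u(·)`. -/
def HBar (T : ℝ) : H1ZeroLeft T →ₗ[ℝ] H1ZeroRight T where
  toFun u := ⟨fun t => (u : ℝ → ℝ) T - (u : ℝ → ℝ) t, by
    obtain ⟨⟨hu, g, hg⟩, -⟩ := u.2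
    refine ⟨?_, by simp⟩
    have hc : (fun _ => (u : ℝ → ℝ) T) ∈ H1 T :=
      ⟨continuousOn_const, 0, isL2WeakDeriv_const T _⟩
    exact (H1 T).sub_mem hc ⟨hu, g, hg⟩⟩
  map_add' u v := by
    ext t
    simp only [Submodule.coe_add, Pi.add_apply]
    ring
  map_smul' c u := by
    ext t
    simp only [Submodule.coe_smul, Pi.smul_apply, smul_eq_mul, RingHom.id_apply]
    ring

/-- The B-spline `b_{j,p}` of degree `p` over the knots `ξ j ≤ … ≤ ξ (j+p+1)`, by the
Cox–de Boor recursion (with `0/0 = 0`). -/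
def bspline (ξ : ℕ → ℝ) : ℕ → ℕ → ℝ → ℝ
  | 0, j, x => if ξ j ≤ x ∧ x < ξ (j + 1) then 1 else 0
  | p + 1, j, x =>
    if ξ j ≤ x ∧ x < ξ (j + p + 2) then
      (x - ξ j) / (ξ (j + p + 1) - ξ j) * bspline ξ p j x +
        (ξ (j + p + 2) - x) / (ξ (j + p + 2) - ξ (j + 1)) * bspline ξ p (j + 1) x
    else 0

/-- `ξ 1, …, ξ (N+3)` is an open knot vector on `[0,T]` for degree two with simple interior
knots: `0 = ξ 1 = ξ 2 = ξ 3 < ξ 4 < … < ξ (N+1) = ξ (N+2) = ξ (N+3) = T`.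
(For `T > 0` this forces `N ≥ 3`; other values of `ξ` are irrelevant.) -/
structure IsOpenKnotVector (T : ℝ) (N : ℕ) (ξ : ℕ → ℝ) : Prop where
  left_one : ξ 1 = 0
  left_two : ξ 2 = 0
  left_three : ξ 3 = 0
  lt_succ : ∀ i, 3 ≤ i → i ≤ N → ξ i < ξ (i + 1)
  right_one : ξ (N + 1) = T
  right_two : ξ (N + 2) = T
  right_three : ξ (N + 3) = T

/-- The mesh-size `h = max {|ξ (i+1) - ξ i| : i = 1, …, N+2}`. -/
def meshSize (N : ℕ) (ξ : ℕ → ℝ) : ℝ :=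
  (Finset.Icc 1 (N + 2)).sup' ⟨1, by simp⟩ (fun i => |ξ (i + 1) - ξ i|)

/-- The quadratic basis function `b_{i,2}` on `[0,T]`; its value at the right endpoint `T` is
the limit from the left. (It vanishes outside `[0,T]`.) -/
def basisFun (T : ℝ) (ξ : ℕ → ℝ) (i : ℕ) : ℝ → ℝ :=
  Function.update (bspline ξ 2 i) T (Function.leftLim (bspline ξ 2 i) T)

/-- The quadratic spline space `S²_h = span {b_{i,2} : i = 1, …, N}`. -/
def splineSpace (T : ℝ) (N : ℕ) (ξ : ℕ → ℝ) : Submodule ℝ (ℝ → ℝ) :=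
  Submodule.span ℝ (basisFun T ξ '' Icc 1 N)

/-- The discrete space `V^h_{0,*} = S²_h ∩ H¹_{0,*}(0,T)`, as a subspace of `H¹_{0,*}(0,T)`. -/
def discreteSpace (T : ℝ) (N : ℕ) (ξ : ℕ → ℝ) : Submodule ℝ (H1ZeroLeft T) :=
  (splineSpace T N ξ).comap (H1ZeroLeft T).subtype

end

end IGA

/-!
Write `x = √μ T`, `p = u'`, `q = v'` and `U(t) = ∫₀ᵗ u`, so that `U'' = p`. An integration by parts
(`bilinForm_HBar_eq`) gives `a(u, H̄_T v) = ⟨q, f⟩` in `L²(0,T)`, with `f = p + μ U`. The derivatives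
of the splines in `V^h_{0,*}` are exactly the continuous piecewise linear functions over the mesh
(`exists_primitive_of_mem_discreteSpace`, `exists_mem_discreteSpace_primitive`), because a quadratic
B-spline is a difference of two ramps, each of which is a multiple of the primitive of a hat
function (`bspline_two_eq`, `ramp_eq_integral`). Hence the supremum in question is that of
`⟨q, f⟩ / ‖q‖` over the continuous piecewise linear `q ≠ 0`. It is finite by the Cauchy–Schwarz
inequality.

For the lower bound `q` is taken to be the piecewise linear interpolant of `f`. Since `p` is its own
interpolant, `f - q` is `μ` times the interpolation error of `U`; a Poincaré inequality on each mesh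
interval, whose squared length is at most `h T`, gives `‖f - q‖ ≤ ε := μ h T ‖p‖ / 9`
(`integral_sq_sub_linInterp_le`). The identity `2 ⟨q, f⟩ = ‖q‖² + ‖f‖² - ‖f - q‖²` then yields
`⟨q, f⟩ / ‖q‖ ≥ √(‖f‖² - ε²)`.

The Duhamel formula for `U'' + μ U = f` gives the stability bound `‖p‖ ≤ (1 + x / √2) ‖f‖`
(`integral_sq_le_of_wave`). Together with the condition on `h` it implies
`‖f‖² - ε² ≥ ‖p‖² / (2 + x)²` (`sq_div_le_sub`), and `1 / (2 + x)` is at least the claimed constant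
(`infSup_const_le`).
-/

namespace IGA

/-! ### Hat functions and quadratic B-splines -/

/-- The hat function with nodes `a ≤ b ≤ c` and peak value `1` at `b`. A degenerate side (`a = b`
or `b = c`) is replaced by the constant `1`, so that the function is continuous on all of `ℝ`; it
is then the usual half hat only on the nondegenerate side of `b`. -/
noncomputable def hat (a b c x : ℝ) : ℝ :=
  max 0 (min (if a < b then (x - a) / (b - a) else 1) (if b < c then (c - x) / (c - b) else 1))

/-- The quadratic ramp with nodes `a ≤ b ≤ c`: it rises from `0` to `1` between `a` and `c`, and
for `a < c` its derivative is `2 / (c - a)` times the usual hat function, which vanishes off `[a, c]`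
(see `ramp_eq_integral` for the relation to `hat`). For `a = b = c` it is the unit
step at `a`. -/
noncomputable def ramp (a b c x : ℝ) : ℝ :=
  if x < a then 0 else if x < b then (x - a) ^ 2 / ((c - a) * (b - a))
  else if x < c then 1 - (c - x) ^ 2 / ((c - a) * (c - b)) else 1

theorem continuous_hat (a b c : ℝ) : Continuous (hat a b c) := by
  unfold hat
  refine continuous_const.max (Continuous.min ?_ ?_)
  · split_ifs <;> fun_prop
  · split_ifs <;> fun_prop

theorem hat_of_mem_left {a b c x : ℝ} (hab : a < b) (hx : x ∈ Icc a b) :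
    hat a b c x = (x - a) / (b - a) := by
  have h1 : 0 < b - a := sub_pos.2 hab
  have h2 : (x - a) / (b - a) ≤ 1 := by
    rw [div_le_one h1]
    linarith [hx.2]
  have h3 : 0 ≤ (x - a) / (b - a) := div_nonneg (by linarith [hx.1]) h1.le
  unfold hat
  rw [if_pos hab, min_eq_left, max_eq_right h3]
  split_ifs with hbc
  · refine h2.trans ?_
    rw [one_le_div (by linarith)]
    linarith [hx.2]
  · exact h2

theorem hat_of_mem_right {a b c x : ℝ} (hbc : b < c) (hx : x ∈ Icc b c) :
    hat a b c x = (c - x) / (c - b) := by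
  have h1 : 0 < c - b := sub_pos.2 hbc
  have h2 : (c - x) / (c - b) ≤ 1 := by
    rw [div_le_one h1]
    linarith [hx.1]
  have h3 : 0 ≤ (c - x) / (c - b) := div_nonneg (by linarith [hx.2]) h1.le
  unfold hat
  rw [if_pos hbc, min_eq_right, max_eq_right h3]
  split_ifs with hab
  · refine h2.trans ?_
    rw [one_le_div (by linarith)]
    linarith [hx.1]
  · exact h2

theorem hat_of_le {a b c x : ℝ} (hab : a < b) (hx : x ≤ a) : hat a b c x = 0 := by
  unfold hat
  rw [if_pos hab]
  exact max_eq_left ((min_le_left _ _).trans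
    (div_nonpos_of_nonpos_of_nonneg (by linarith) (by linarith)))

theorem hat_of_ge {a b c x : ℝ} (hbc : b < c) (hx : c ≤ x) : hat a b c x = 0 := by
  unfold hat
  rw [if_pos hbc]
  exact max_eq_left ((min_le_right _ _).trans
    (div_nonpos_of_nonpos_of_nonneg (by linarith) (by linarith)))

/-- For `a < c` the quadratic ramp is continuous: with `x` clamped to `[a, b]` and to `[b, c]`, it
is a sum of two squares, where division by a vanishing length correctly drops a degenerate side. -/
theorem ramp_eq_clamp {a b c : ℝ} (hab : a ≤ b) (hbc : b ≤ c) (hac : a < c) (x : ℝ) :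
    ramp a b c x = (max a (min x b) - a) ^ 2 / ((c - a) * (b - a)) +
      ((c - b) ^ 2 - (c - max b (min x c)) ^ 2) / ((c - a) * (c - b)) := by
  have h0 : c - a ≠ 0 := by linarith
  unfold ramp
  split_ifs with h1 h2 h3
  · rw [min_eq_left (by linarith), max_eq_left h1.le, min_eq_left (by linarith),
      max_eq_left (by linarith)]
    simp
  · rw [min_eq_left h2.le, max_eq_right (by linarith), min_eq_left (by linarith),
      max_eq_left h2.le]
    simp
  · rw [min_eq_right (by linarith), max_eq_right hab, min_eq_left h3.le,
      max_eq_right (by linarith)]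
    have h4 : c - b ≠ 0 := by linarith
    rcases hab.eq_or_lt with rfl | hab
    · field_simp
      ring
    · have h5 : b - a ≠ 0 := by linarith
      field_simp
      ring
  · rw [min_eq_right (by linarith), max_eq_right hab, min_eq_right (by linarith),
      max_eq_right hbc]
    rcases hab.eq_or_lt with rfl | hab
    · field_simp
      ring
    · have h5 : b - a ≠ 0 := by linarith
      rcases hbc.eq_or_lt with rfl | hbc
      · field_simp
        ring
      · have h4 : c - b ≠ 0 := by linarith
        field_simp
        ring

/-- On `[0,T]` the ramp is a multiple of the primitive of the hat function, provided the nodes on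
the left coincide only at `0` and those on the right only at `T`: then the side on which `hat` takes
the wrong value `1` lies outside the interval. -/
theorem ramp_eq_integral {T a b c x : ℝ} (ha : 0 ≤ a) (hab : a ≤ b) (hbc : b ≤ c) (hac : a < c)
    (ha0 : a = b → a = 0) (hcT : b = c → c = T) (hx : x ∈ Icc 0 T) :
    ramp a b c x = 2 / (c - a) * ∫ t in (0 : ℝ)..x, hat a b c t := by
  have h0 : c - a ≠ 0 := by linarith
  have hcont : Continuous (ramp a b c) := by
    rw [funext (ramp_eq_clamp hab hbc hac)]
    fun_prop
  have hd : ∀ t ∈ Ioo 0 x \ {a, b, c},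
      HasDerivAt (ramp a b c) (2 / (c - a) * hat a b c t) t := by
    rintro t ⟨⟨ht0, htx⟩, ht⟩
    simp only [mem_insert_iff, mem_singleton_iff, not_or] at ht
    obtain ⟨hta, htb, htc⟩ := ht
    -- Near `t` the ramp agrees with the polynomial of the piece that contains `t`.
    have key : ∀ (l r : ℝ) (F : ℝ → ℝ) (d : ℝ), l < t → t < r →
        (∀ s, l < s → s < r → ramp a b c s = F s) → HasDerivAt F d t →
        HasDerivAt (ramp a b c) d t := by
      intro l r F d hl hr hF hFd
      refine hFd.congr_of_eventuallyEq ?_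
      filter_upwards [Ioo_mem_nhds hl hr] with s hs using hF s hs.1 hs.2
    rcases lt_or_gt_of_ne hta with h1 | h1
    · have hab' : a < b := lt_of_le_of_ne hab fun h => by linarith [ha0 h]
      rw [hat_of_le hab' h1.le, mul_zero]
      refine key 0 a _ _ ht0 h1 (fun s _ hs => ?_) (hasDerivAt_const t (0 : ℝ))
      simp [ramp, hs]
    rcases lt_or_gt_of_ne htb with h2 | h2
    · have hab' : a < b := h1.trans h2
      rw [hat_of_mem_left hab' ⟨h1.le, h2.le⟩]
      refine key a b (fun s => (s - a) ^ 2 / ((c - a) * (b - a))) _ h1 h2 (fun s hs1 hs2 => ?_) ?_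
      · simp [ramp, hs1.le.not_gt, hs2]
      · have h := (((hasDerivAt_id' t).sub_const a).fun_pow 2).div_const ((c - a) * (b - a))
        refine h.congr_deriv ?_
        have : b - a ≠ 0 := by linarith
        field_simp
        push_cast
        ring
    rcases lt_or_gt_of_ne htc with h3 | h3
    · have hbc' : b < c := h2.trans h3
      rw [hat_of_mem_right hbc' ⟨h2.le, h3.le⟩]
      refine key b c (fun s => 1 - (c - s) ^ 2 / ((c - a) * (c - b))) _ h2 h3
        (fun s hs1 hs2 => ?_) ?_
      · simp [ramp, hs1.le.not_gt, hs2, (hab.trans hs1.le).not_gt]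
      · have h := ((((hasDerivAt_id' t).const_sub c).fun_pow 2).div_const
          ((c - a) * (c - b))).const_sub 1
        refine h.congr_deriv ?_
        have : c - b ≠ 0 := by linarith
        field_simp
        push_cast
        ring
    · have hbc' : b < c := lt_of_le_of_ne hbc fun h => by linarith [hcT h, hx.2]
      rw [hat_of_ge hbc' h3.le, mul_zero]
      refine key c (t + 1) _ _ h3 (by linarith) (fun s hs _ => ?_) (hasDerivAt_const t (1 : ℝ))
      simp [ramp, hs.le.not_gt, (hbc.trans hs.le).not_gt, (hac.trans hs).le.not_gt]
  have h := integral_eq_of_hasDerivAt_off_countable_of_le (ramp a b c) _ hx.1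
    ((countable_singleton c).insert b |>.insert a) hcont.continuousOn hd
    ((continuous_const.mul (continuous_hat a b c)).intervalIntegrable _ _)
  have hr0 : ramp a b c 0 = 0 := by
    rw [ramp_eq_clamp hab hbc hac, min_eq_left (ha.trans hab), max_eq_left ha,
      min_eq_left (by linarith), max_eq_left (ha.trans hab)]
    simp
  rw [intervalIntegral.integral_const_mul, hr0, sub_zero] at h
  exact h.symm

/-- A quadratic B-spline is the difference of two consecutive quadratic ramps. -/
theorem bspline_two_eq {ξ : ℕ → ℝ} {i : ℕ} (h1 : ξ i ≤ ξ (i + 1)) (h2 : ξ (i + 1) ≤ ξ (i + 2))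
    (h3 : ξ (i + 2) ≤ ξ (i + 3)) (x : ℝ) :
    bspline ξ 2 i x =
      ramp (ξ i) (ξ (i + 1)) (ξ (i + 2)) x - ramp (ξ (i + 1)) (ξ (i + 2)) (ξ (i + 3)) x := by
  simp only [bspline, ramp, show i + 1 + 1 = i + 2 from rfl, show i + 1 + 0 + 2 = i + 3 from rfl,
    show i + 0 + 1 = i + 1 from rfl]
  generalize ξ i = a at *
  generalize ξ (i + 1) = b at *
  generalize ξ (i + 2) = c at *
  generalize ξ (i + 3) = d at *
  by_cases hxa : x < a
  · simp [hxa, hxa.not_ge, hxa.trans_le h1]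
  by_cases hxb : x < b
  · have : b - a ≠ 0 := by linarith
    have : c - a ≠ 0 := by linarith
    simp [hxa, hxb, hxb.not_ge, not_lt.1 hxa, show x < c by linarith, show x < d by linarith]
    field_simp
  by_cases hxc : x < c
  · have : c - b ≠ 0 := by linarith
    have : c - a ≠ 0 := by linarith
    have : d - b ≠ 0 := by linarith
    simp [hxa, hxb, hxc, hxc.not_ge, not_lt.1 hxa, not_lt.1 hxb, show x < d by linarith]
    field_simp
    ring
  by_cases hxd : x < d
  · have : d - b ≠ 0 := by linarith
    have : d - c ≠ 0 := by linarith
    simp [hxa, hxb, hxc, hxd, not_lt.1 hxa, not_lt.1 hxb, not_lt.1 hxc]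
    field_simp
  · simp [hxa, hxb, hxc, hxd]

/-! ### The quadratic splines as primitives of continuous piecewise linear functions -/

namespace IsOpenKnotVector

variable {T : ℝ} {N : ℕ} {ξ : ℕ → ℝ}

theorem three_le (h : IsOpenKnotVector T N ξ) (hT : 0 < T) : 3 ≤ N := by
  by_contra! hN
  interval_cases N
  · linarith [h.left_one, h.right_one]
  · linarith [h.left_two, h.right_one]
  · linarith [h.left_three, h.right_one]

theorem le_succ (h : IsOpenKnotVector T N ξ) (i : ℕ) (h1 : 1 ≤ i) (hi : i ≤ N + 2) :
    ξ i ≤ ξ (i + 1) := by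
  rcases Nat.lt_or_ge i 3 with h3 | h3
  · interval_cases i
    · exact (h.left_one.trans h.left_two.symm).le
    · exact (h.left_two.trans h.left_three.symm).le
  rcases Nat.lt_or_ge N i with hN | hN
  · obtain rfl | rfl : i = N + 1 ∨ i = N + 2 := by omega
    · exact (h.right_one.trans h.right_two.symm).le
    · exact (h.right_two.trans h.right_three.symm).le
  · exact (h.lt_succ i h3 hN).le

theorem mono (h : IsOpenKnotVector T N ξ) {i j : ℕ} (h1 : 1 ≤ i) (hij : i ≤ j) (hj : j ≤ N + 3) :
    ξ i ≤ ξ j := by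
  induction j, hij using Nat.le_induction with
  | base => exact le_rfl
  | succ j hij ih => exact (ih (by omega)).trans (h.le_succ j (by omega) (by omega))

theorem nonneg (h : IsOpenKnotVector T N ξ) {i : ℕ} (h1 : 1 ≤ i) (hi : i ≤ N + 3) : 0 ≤ ξ i :=
  h.left_one.symm.le.trans (h.mono le_rfl h1 hi)

theorem le_right (h : IsOpenKnotVector T N ξ) {i : ℕ} (h1 : 1 ≤ i) (hi : i ≤ N + 3) : ξ i ≤ T :=
  (h.mono h1 hi le_rfl).trans h.right_three.le

theorem lt_add_two (h : IsOpenKnotVector T N ξ) {i : ℕ} (h2 : 2 ≤ i) (hi : i ≤ N) (hN : 3 ≤ N) :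
    ξ i < ξ (i + 2) := by
  rcases h2.eq_or_lt with rfl | h3
  · exact (h.left_two.trans h.left_three.symm).le.trans_lt (h.lt_succ 3 le_rfl hN)
  · exact (h.lt_succ i h3 hi).trans_le (h.le_succ _ (by omega) (by omega))

end IsOpenKnotVector

/-- The hat function attached to the three consecutive knots from `ξ j`. -/
noncomputable abbrev knotHat (ξ : ℕ → ℝ) (j : ℕ) : ℝ → ℝ := hat (ξ j) (ξ (j + 1)) (ξ (j + 2))

/-- The continuous piecewise linear function over the mesh with value `y k` at the knot `ξ k`,
`3 ≤ k ≤ N + 1`. -/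
noncomputable def linInterp (N : ℕ) (ξ : ℕ → ℝ) (y : ℕ → ℝ) (x : ℝ) : ℝ :=
  ∑ j ∈ Finset.Icc 2 N, y (j + 1) * knotHat ξ j x

theorem continuous_linInterp (N : ℕ) (ξ y : ℕ → ℝ) : Continuous (linInterp N ξ y) := by
  unfold linInterp
  exact continuous_finsetSum _ fun j _ => continuous_const.mul (continuous_hat _ _ _)

theorem linInterp_add (N : ℕ) (ξ y z : ℕ → ℝ) (x : ℝ) :
    linInterp N ξ (y + z) x = linInterp N ξ y x + linInterp N ξ z x := by
  simp [linInterp, add_mul, Finset.sum_add_distrib]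

theorem linInterp_smul (N : ℕ) (ξ : ℕ → ℝ) (c : ℝ) (y : ℕ → ℝ) (x : ℝ) :
    linInterp N ξ (c • y) x = c * linInterp N ξ y x := by
  simp [linInterp, mul_assoc, Finset.mul_sum]

theorem linInterp_single {N j : ℕ} (ξ : ℕ → ℝ) (hj : j ∈ Finset.Icc 2 N) (x : ℝ) :
    linInterp N ξ (Pi.single (j + 1) 1) x = knotHat ξ j x := by
  unfold linInterp
  rw [Finset.sum_eq_single_of_mem j hj]
  · simp
  · intro k _ hk
    simp [hk]

theorem linInterp_of_mem {T : ℝ} {N : ℕ} {ξ : ℕ → ℝ} (h : IsOpenKnotVector T N ξ) (y : ℕ → ℝ)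
    {k : ℕ} (h3 : 3 ≤ k) (hk : k ≤ N) {x : ℝ} (hx : x ∈ Icc (ξ k) (ξ (k + 1))) :
    linInterp N ξ y x = y k * ((ξ (k + 1) - x) / (ξ (k + 1) - ξ k)) +
      y (k + 1) * ((x - ξ k) / (ξ (k + 1) - ξ k)) := by
  obtain ⟨m, rfl⟩ : ∃ m, k = m + 1 := ⟨k - 1, by omega⟩
  unfold linInterp knotHat
  rw [Finset.sum_eq_add_of_mem m (m + 1) (Finset.mem_Icc.2 ⟨by omega, by omega⟩)
    (Finset.mem_Icc.2 ⟨by omega, by omega⟩) (by omega)]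
  · rw [hat_of_mem_right (h.lt_succ _ h3 hk) hx, hat_of_mem_left (h.lt_succ _ h3 hk) hx]
  · intro j hj hne
    rw [Finset.mem_Icc] at hj
    rcases Nat.lt_or_ge j m with hjm | hjm
    · rw [hat_of_ge (h.lt_succ _ (by omega) (by omega))
        ((h.mono (by omega) (by omega) (by omega)).trans hx.1), mul_zero]
    · rw [hat_of_le (h.lt_succ _ (by omega) (by omega))
        (hx.2.trans (h.mono (by omega) (by omega) (by omega))), mul_zero]

/-- On `[0,T)` the ramp over the knots from `ξ i` is, up to the constant `1` for `i = 1`, a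
multiple of the primitive of the hat function. For `i = 1` and `i = N + 1` the three knots
coincide, and the factor `2 / 0 = 0` removes the primitive. -/
theorem ramp_knot_eq {T : ℝ} {N : ℕ} {ξ : ℕ → ℝ} (h : IsOpenKnotVector T N ξ) (hN : 3 ≤ N)
    {i : ℕ} (h1 : 1 ≤ i) (hi : i ≤ N + 1) {x : ℝ} (hx : x ∈ Ico 0 T) :
    ramp (ξ i) (ξ (i + 1)) (ξ (i + 2)) x = (if i = 1 then 1 else 0) +
      2 / (ξ (i + 2) - ξ i) * ∫ t in (0 : ℝ)..x, knotHat ξ i t := by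
  rcases h1.eq_or_lt with rfl | h2
  · have e1 : ξ (1 + 1) = 0 := h.left_two
    have e2 : ξ (1 + 2) = 0 := h.left_three
    simp [ramp, h.left_one, e1, e2, hx.1.not_gt]
  rcases Nat.lt_or_ge N i with hNi | hNi
  · obtain rfl : i = N + 1 := by omega
    simp [ramp, h.right_one,
      show ξ (N + 1 + 2) = T from h.right_three, hx.2, show N ≠ 0 by omega]
  · rw [if_neg (by omega), zero_add]
    refine ramp_eq_integral (h.nonneg h1 (by omega)) (h.le_succ i h1 (by omega))
      (h.le_succ _ (by omega) (by omega)) (h.lt_add_two h2 hNi hN) (fun he => ?_) (fun he => ?_)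
      ⟨hx.1, hx.2.le⟩
    · obtain rfl : i = 2 := by
        by_contra hne
        exact (h.lt_succ i (by omega) hNi).ne he
      exact h.left_two
    · obtain rfl : i = N := by
        by_contra hne
        exact (h.lt_succ (i + 1) (by omega) (by omega)).ne he
      exact h.right_two

/-- A B-spline on the closed interval `[0,T]`; the convention for the value at `T` makes both
sides continuous there. -/
theorem basisFun_eq {T : ℝ} {N : ℕ} {ξ : ℕ → ℝ} (h : IsOpenKnotVector T N ξ) (hT : 0 < T)
    {i : ℕ} (h1 : 1 ≤ i) (hi : i ≤ N) {x : ℝ} (hx : x ∈ Icc 0 T) :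
    basisFun T ξ i x = (if i = 1 then 1 else 0) +
      2 / (ξ (i + 2) - ξ i) * (∫ t in (0 : ℝ)..x, knotHat ξ i t) -
      2 / (ξ (i + 3) - ξ (i + 1)) * ∫ t in (0 : ℝ)..x, knotHat ξ (i + 1) t := by
  have hN := h.three_le hT
  set G : ℝ → ℝ := fun x => (if i = 1 then 1 else 0) +
      2 / (ξ (i + 2) - ξ i) * (∫ t in (0 : ℝ)..x, knotHat ξ i t) -
      2 / (ξ (i + 3) - ξ (i + 1)) * ∫ t in (0 : ℝ)..x, knotHat ξ (i + 1) t with hG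
  have hGc : Continuous G := by
    have c1 := intervalIntegral.continuous_primitive
      (fun a b => (continuous_hat (ξ i) (ξ (i + 1)) (ξ (i + 2))).intervalIntegrable
        (μ := volume) a b) 0
    have c2 := intervalIntegral.continuous_primitive
      (fun a b => (continuous_hat (ξ (i + 1)) (ξ (i + 2)) (ξ (i + 3))).intervalIntegrable
        (μ := volume) a b) 0
    exact (continuous_const.add (continuous_const.mul c1)).sub (continuous_const.mul c2)
  have hb : ∀ x ∈ Ico 0 T, bspline ξ 2 i x = G x := by
    intro x hx
    rw [bspline_two_eq (h.le_succ i h1 (by omega)) (h.le_succ _ (by omega) (by omega))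
      (h.le_succ _ (by omega) (by omega)), ramp_knot_eq h hN h1 (by omega) hx,
      ramp_knot_eq h hN (i := i + 1) (by omega) (by omega) hx,
      if_neg (show i + 1 ≠ 1 by omega), zero_add]
  change basisFun T ξ i x = G x
  unfold basisFun
  rcases hx.2.eq_or_lt with rfl | hxT
  · rw [Function.update_self]
    refine leftLim_eq_of_tendsto
      ((hGc.continuousAt.tendsto.mono_left nhdsWithin_le_nhds).congr' ?_)
    filter_upwards [Ioo_mem_nhdsLT hT] with y hy using (hb y ⟨hy.1.le, hy.2⟩).symm
  · rw [Function.update_of_ne hxT.ne]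
    exact hb x ⟨hx.1, hxT⟩

/-- Every quadratic spline is, up to a constant, the primitive of a continuous piecewise linear
function. -/
theorem exists_primitive_of_mem_splineSpace {T : ℝ} {N : ℕ} {ξ : ℕ → ℝ}
    (h : IsOpenKnotVector T N ξ) (hT : 0 < T) {u : ℝ → ℝ} (hu : u ∈ splineSpace T N ξ) :
    ∃ y : ℕ → ℝ, ∃ c : ℝ, ∀ x ∈ Icc 0 T, u x = c + ∫ t in (0 : ℝ)..x, linInterp N ξ y t := by
  have hN := h.three_le hT
  have hint : ∀ (y : ℕ → ℝ) (a b : ℝ), IntervalIntegrable (linInterp N ξ y) volume a b :=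
    fun y a b => (continuous_linInterp N ξ y).intervalIntegrable a b
  have hprim : ∀ i, 1 ≤ i → i ≤ N + 1 → ∃ y : ℕ → ℝ, ∀ x,
      2 / (ξ (i + 2) - ξ i) * (∫ t in (0 : ℝ)..x, knotHat ξ i t) =
        ∫ t in (0 : ℝ)..x, linInterp N ξ y t := by
    intro i h1 hi
    by_cases hi2 : i ∈ Finset.Icc 2 N
    · refine ⟨(2 / (ξ (i + 2) - ξ i)) • Pi.single (i + 1) 1, fun x => ?_⟩
      simp_rw [linInterp_smul, linInterp_single ξ hi2]
      rw [intervalIntegral.integral_const_mul]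
    · refine ⟨0, fun x => ?_⟩
      have : ξ (i + 2) - ξ i = 0 := by
        rw [Finset.mem_Icc, not_and_or] at hi2
        obtain rfl | rfl : i = 1 ∨ i = N + 1 := by omega
        · rw [show ξ (1 + 2) = 0 from h.left_three, h.left_one, sub_zero]
        · rw [show ξ (N + 1 + 2) = T from h.right_three, h.right_one, sub_self]
      simp [this, linInterp]
  refine Submodule.span_induction ?_ ?_ ?_ ?_ hu
  · rintro _ ⟨i, ⟨h1, hi⟩, rfl⟩
    obtain ⟨y, hy⟩ := hprim i h1 (by omega)
    obtain ⟨z, hz⟩ := hprim (i + 1) (by omega) (by omega)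
    refine ⟨y + (-1 : ℝ) • z, if i = 1 then 1 else 0, fun x hx => ?_⟩
    rw [basisFun_eq h hT h1 hi hx, hy, show ξ (i + 3) = ξ (i + 1 + 2) from rfl, hz]
    simp_rw [linInterp_add, linInterp_smul]
    rw [intervalIntegral.integral_add (hint _ _ _) ((hint _ _ _).const_mul _),
      intervalIntegral.integral_const_mul]
    ring
  · exact ⟨0, 0, fun x _ => by simp [linInterp]⟩
  · rintro u v - - ⟨y, c, hy⟩ ⟨z, d, hz⟩
    refine ⟨y + z, c + d, fun x hx => ?_⟩
    simp_rw [linInterp_add]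
    rw [intervalIntegral.integral_add (hint _ _ _) (hint _ _ _), Pi.add_apply, hy x hx, hz x hx]
    ring
  · rintro a u - ⟨y, c, hy⟩
    refine ⟨a • y, a * c, fun x hx => ?_⟩
    simp_rw [linInterp_smul]
    rw [intervalIntegral.integral_const_mul, Pi.smul_apply, smul_eq_mul, hy x hx]
    ring

/-- Every continuous piecewise linear function has a primitive in the quadratic spline space: the
primitive of a single hat function is a multiple of a telescoping sum of B-splines. -/
theorem exists_mem_splineSpace_primitive {T : ℝ} {N : ℕ} {ξ : ℕ → ℝ}
    (h : IsOpenKnotVector T N ξ) (hT : 0 < T) (y : ℕ → ℝ) :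
    ∃ v ∈ splineSpace T N ξ, ∀ x ∈ Icc 0 T, v x = ∫ t in (0 : ℝ)..x, linInterp N ξ y t := by
  have hN := h.three_le hT
  have hhat : ∀ j ∈ Finset.Icc 2 N, ∃ v ∈ splineSpace T N ξ, ∀ x ∈ Icc 0 T,
      v x = ∫ t in (0 : ℝ)..x, knotHat ξ j t := by
    intro j hj
    rw [Finset.mem_Icc] at hj
    have hpos := sub_pos.2 (h.lt_add_two hj.1 hj.2 hN)
    refine ⟨((ξ (j + 2) - ξ j) / 2) • ∑ i ∈ Finset.Ico j (N + 1), basisFun T ξ i,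
      Submodule.smul_mem _ _ (Submodule.sum_mem _ fun i hi => Submodule.subset_span
        ⟨i, ?_, rfl⟩), fun x hx => ?_⟩
    · rw [Finset.mem_Ico] at hi
      exact ⟨by omega, by omega⟩
    · let R : ℕ → ℝ := fun i => 2 / (ξ (i + 2) - ξ i) * ∫ t in (0 : ℝ)..x, knotHat ξ i t
      have hsum : ∑ i ∈ Finset.Ico j (N + 1), basisFun T ξ i x = R j := by
        have hR : R (N + 1) = 0 := by
          simp [R, show ξ (N + 1 + 2) = T from h.right_three, h.right_one]
        rw [Finset.sum_congr rfl (g := fun i => -(R (i + 1) - R i)), Finset.sum_neg_distrib,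
          Finset.sum_Ico_sub R (by omega), hR]
        · ring
        · intro i hi
          rw [Finset.mem_Ico] at hi
          rw [basisFun_eq h hT (by omega) (by omega) hx, if_neg (by omega)]
          simp only [R, show i + 1 + 2 = i + 3 from rfl]
          ring
      rw [Pi.smul_apply, Finset.sum_apply, hsum, smul_eq_mul]
      simp only [R]
      field_simp
  choose! v hv hvx using hhat
  refine ⟨∑ j ∈ Finset.Icc 2 N, y (j + 1) • v j,
    Submodule.sum_mem _ fun j hj => Submodule.smul_mem _ _ (hv j hj), fun x hx => ?_⟩
  simp only [linInterp, Finset.sum_apply, Pi.smul_apply, smul_eq_mul]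
  have hi : ∀ j ∈ Finset.Icc 2 N,
      IntervalIntegrable (fun t => y (j + 1) * knotHat ξ j t) volume 0 x := fun j _ =>
    (continuous_const.mul (continuous_hat _ _ _)).intervalIntegrable _ _
  rw [intervalIntegral.integral_finsetSum hi]
  refine Finset.sum_congr rfl fun j hj => ?_
  rw [hvx j hj x hx, intervalIntegral.integral_const_mul]

/-! ### Integral inequalities -/

theorem sq_integral_mul_le {a b : ℝ} (hab : a ≤ b) {f g : ℝ → ℝ} (hf : Continuous f)
    (hg : Continuous g) :
    (∫ t in a..b, f t * g t) ^ 2 ≤ (∫ t in a..b, f t ^ 2) * ∫ t in a..b, g t ^ 2 := by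
  have h : ∀ x : ℝ, 0 ≤ (∫ t in a..b, g t ^ 2) * (x * x) + (-2 * ∫ t in a..b, f t * g t) * x +
      ∫ t in a..b, f t ^ 2 := by
    intro x
    have h0 : 0 ≤ ∫ t in a..b, (f t - x * g t) ^ 2 :=
      intervalIntegral.integral_nonneg hab fun t _ => sq_nonneg _
    have h1 : ∀ t, (f t - x * g t) ^ 2 = g t ^ 2 * (x * x) + -2 * (f t * g t) * x + f t ^ 2 :=
      fun t => by ring
    simp_rw [h1] at h0
    rw [intervalIntegral.integral_add (Continuous.intervalIntegrable (by fun_prop) _ _)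
      (Continuous.intervalIntegrable (by fun_prop) _ _),
      intervalIntegral.integral_add (Continuous.intervalIntegrable (by fun_prop) _ _)
      (Continuous.intervalIntegrable (by fun_prop) _ _), intervalIntegral.integral_mul_const,
      intervalIntegral.integral_mul_const, intervalIntegral.integral_const_mul] at h0
    exact h0
  have h2 := discrim_le_zero h
  unfold discrim at h2
  nlinarith [h2]

/-- A Poincaré inequality with constant `1/3` in place of the optimal `1/π`. With
`w = -k tan (k (t - m))`, `k = 3 / (b - a)`, `m` the midpoint, one has `w' + w² = -k²`, so that
`e'² - k² e² = (e' - w e)² + (w e²)'`; since `3/2 < π/2`, the function `w` is regular up to the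
end points. -/
theorem nine_mul_integral_sq_le {a b : ℝ} (hab : a < b) {e e' : ℝ → ℝ}
    (he : ∀ t, HasDerivAt e (e' t) t) (hc : Continuous e') (ha : e a = 0) (hb : e b = 0) :
    9 * ∫ t in a..b, e t ^ 2 ≤ (b - a) ^ 2 * ∫ t in a..b, e' t ^ 2 := by
  have hd : 0 < b - a := sub_pos.2 hab
  set k : ℝ := 3 / (b - a) with hk
  set m : ℝ := (a + b) / 2 with hm
  have hec : Continuous e := continuous_iff_continuousAt.2 fun t => (he t).continuousAt
  have hcos : ∀ t ∈ Icc a b, Real.cos (k * (t - m)) ≠ 0 := by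
    intro t ht
    have h1 : |k * (t - m)| ≤ 3 / 2 := by
      rw [abs_mul, abs_of_pos (by positivity : 0 < k), hk, div_mul_eq_mul_div, div_le_iff₀ hd]
      have : |t - m| ≤ (b - a) / 2 := abs_le.2 ⟨by linarith [ht.1], by linarith [ht.2]⟩
      linarith
    have h2 := abs_le.1 h1
    exact (Real.cos_pos_of_mem_Ioo
      ⟨by linarith [Real.pi_gt_three, h2.1], by linarith [Real.pi_gt_three, h2.2]⟩).ne'
  set w : ℝ → ℝ := fun t => -(k * (Real.sin (k * (t - m)) / Real.cos (k * (t - m)))) with hw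
  have hwc : ContinuousOn w (Icc a b) := by
    refine ((ContinuousOn.div ?_ ?_ hcos).const_smul k).neg <;> fun_prop
  have hF : ∀ t ∈ uIcc a b, HasDerivAt (fun t => w t * e t ^ 2)
      (e' t ^ 2 - k ^ 2 * e t ^ 2 - (e' t - w t * e t) ^ 2) t := by
    intro t ht
    rw [uIcc_of_le hab.le] at ht
    have hl : HasDerivAt (fun t => k * (t - m)) (k * 1) t :=
      ((hasDerivAt_id' t).sub_const m).const_mul k
    have hwd := ((hl.sin.div hl.cos (hcos t ht)).const_mul k).neg
    refine (hwd.mul ((he t).fun_pow 2)).congr_deriv ?_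
    have := hcos t ht
    simp only [hw, Pi.div_apply, Pi.neg_apply]
    field_simp
    push_cast
    ring
  have hD : ContinuousOn (fun t => e' t ^ 2 - k ^ 2 * e t ^ 2 - (e' t - w t * e t) ^ 2)
      (Icc a b) := by fun_prop
  have hint := intervalIntegral.integral_eq_sub_of_hasDerivAt hF
    (hD.intervalIntegrable_of_Icc hab.le)
  rw [ha, hb] at hint
  have hle := intervalIntegral.integral_mono_on (μ := volume)
    (g := fun t => e' t ^ 2 - k ^ 2 * e t ^ 2) hab.le
    (hD.intervalIntegrable_of_Icc hab.le) (Continuous.intervalIntegrable (by fun_prop) _ _)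
    (fun t _ => by linarith [sq_nonneg (e' t - w t * e t)])
  rw [hint, intervalIntegral.integral_sub (Continuous.intervalIntegrable (by fun_prop) _ _)
    (Continuous.intervalIntegrable (by fun_prop) _ _), intervalIntegral.integral_const_mul, hk,
    div_pow, div_mul_eq_mul_div] at hle
  have h3 : (3 : ℝ) ^ 2 * (∫ t in a..b, e t ^ 2) / (b - a) ^ 2 ≤ ∫ t in a..b, e' t ^ 2 := by
    linarith
  rw [div_le_iff₀ (by positivity)] at h3
  linarith

/-- The second order estimate behind the error of piecewise linear interpolation. -/
theorem integral_sq_le_integral_sq_deriv_deriv {a b : ℝ} (hab : a < b) {e e' p : ℝ → ℝ}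
    (he : ∀ t, HasDerivAt e (e' t) t) (he' : ∀ t, HasDerivAt e' (p t) t) (hp : Continuous p)
    (ha : e a = 0) (hb : e b = 0) :
    ∫ t in a..b, e t ^ 2 ≤ ((b - a) ^ 2 / 9) ^ 2 * ∫ t in a..b, p t ^ 2 := by
  have hec : Continuous e := continuous_iff_continuousAt.2 fun t => (he t).continuousAt
  have hec' : Continuous e' := continuous_iff_continuousAt.2 fun t => (he' t).continuousAt
  have h1 := nine_mul_integral_sq_le hab he hec' ha hb
  have h2 : ∫ t in a..b, e' t ^ 2 = -∫ t in a..b, e t * p t := by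
    have h := intervalIntegral.integral_mul_deriv_eq_deriv_mul (u := e) (v := e') (u' := e')
      (v' := p) (a := a) (b := b) (fun t _ => he t) (fun t _ => he' t)
      (hec'.intervalIntegrable _ _) (hp.intervalIntegrable _ _)
    rw [ha, hb] at h
    simp only [sq]
    linarith
  have h3 := sq_integral_mul_le hab.le hec hp
  have h4 : 0 ≤ ∫ t in a..b, e t ^ 2 :=
    intervalIntegral.integral_nonneg hab.le fun t _ => sq_nonneg _
  rw [h2] at h1
  set A := ∫ t in a..b, e t ^ 2
  set D := ∫ t in a..b, p t ^ 2
  set B := ∫ t in a..b, e t * p t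
  rcases h4.eq_or_lt with h0 | h0
  · rw [← h0]
    exact mul_nonneg (sq_nonneg _) (intervalIntegral.integral_nonneg hab.le fun t _ => sq_nonneg _)
  · have h5 : (9 * A) ^ 2 ≤ ((b - a) ^ 2 * -B) ^ 2 := pow_le_pow_left₀ (by positivity) h1 2
    have h6 : ((b - a) ^ 2 * -B) ^ 2 ≤ ((b - a) ^ 2) ^ 2 * (A * D) := by
      rw [mul_pow, neg_sq]
      gcongr
    refine le_of_mul_le_mul_left ?_ h0
    nlinarith [h5.trans h6]

/-- The Duhamel formula `k U(t) = ∫₀ᵗ sin (k (t - s)) (U'' + k² U)(s) ds`. -/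
theorem mul_eq_integral_sin_mul {U u p : ℝ → ℝ} (hU : ∀ t, HasDerivAt U (u t) t)
    (hu : ∀ t, HasDerivAt u (p t) t) (hp : Continuous p) (hU0 : U 0 = 0) (hu0 : u 0 = 0)
    (k t : ℝ) :
    k * U t = ∫ s in (0 : ℝ)..t, Real.sin (k * (t - s)) * (p s + k ^ 2 * U s) := by
  have hUc : Continuous U := continuous_iff_continuousAt.2 fun t => (hU t).continuousAt
  have h : ∀ s ∈ uIcc 0 t, HasDerivAt
      (fun s => Real.sin (k * (t - s)) * u s + k * (Real.cos (k * (t - s)) * U s))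
      (Real.sin (k * (t - s)) * (p s + k ^ 2 * U s)) s := by
    intro s _
    have hl : HasDerivAt (fun s => k * (t - s)) (k * -1) s :=
      ((hasDerivAt_id' s).const_sub t).const_mul k
    refine ((hl.sin.mul (hu s)).add ((hl.cos.mul (hU s)).const_mul k)).congr_deriv ?_
    ring
  rw [intervalIntegral.integral_eq_sub_of_hasDerivAt h
    (Continuous.intervalIntegrable (by fun_prop) _ _)]
  simp [hU0, hu0]

/-- Stability of the initial value problem `U'' + μ U = f`, `U(0) = U'(0) = 0`. -/
theorem integral_sq_le_of_wave {T μ : ℝ} (hT : 0 < T) (hμ : 0 < μ) {U u p : ℝ → ℝ}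
    (hU : ∀ t, HasDerivAt U (u t) t) (hu : ∀ t, HasDerivAt u (p t) t) (hp : Continuous p)
    (hU0 : U 0 = 0) (hu0 : u 0 = 0) :
    ∫ t in (0 : ℝ)..T, p t ^ 2 ≤
      (1 + Real.sqrt μ * T / Real.sqrt 2) ^ 2 * ∫ t in (0 : ℝ)..T, (p t + μ * U t) ^ 2 := by
  have hUc : Continuous U := continuous_iff_continuousAt.2 fun t => (hU t).continuousAt
  set F := ∫ t in (0 : ℝ)..T, (p t + μ * U t) ^ 2 with hF
  set k := Real.sqrt μ with hk
  have hk2 : k ^ 2 = μ := Real.sq_sqrt hμ.le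
  have hkpos : 0 < k := Real.sqrt_pos.2 hμ
  have hpt : ∀ t ∈ Icc 0 T, (μ * U t) ^ 2 ≤ μ * F * t := by
    intro t ht
    have hcs := sq_integral_mul_le ht.1 (f := fun s => Real.sin (k * (t - s)))
      (g := fun s => p s + μ * U s) (by fun_prop) (by fun_prop)
    have hduh := mul_eq_integral_sin_mul hU hu hp hU0 hu0 k t
    rw [hk2] at hduh
    rw [← hduh] at hcs
    have hs : ∫ s in (0 : ℝ)..t, Real.sin (k * (t - s)) ^ 2 ≤ t := by
      refine (intervalIntegral.integral_mono_on (g := fun _ => (1 : ℝ)) ht.1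
        (Continuous.intervalIntegrable (by fun_prop) _ _)
        (Continuous.intervalIntegrable (by fun_prop) _ _)
        (fun s _ => Real.sin_sq_le_one _)).trans ?_
      simp
    have hFt : ∫ s in (0 : ℝ)..t, (p s + μ * U s) ^ 2 ≤ F :=
      intervalIntegral.integral_mono_interval le_rfl ht.1 ht.2
        (Filter.Eventually.of_forall fun s => sq_nonneg _)
        (Continuous.intervalIntegrable (by fun_prop) _ _)
    have h1 : (k * U t) ^ 2 ≤ t * F :=
      hcs.trans (mul_le_mul hs hFt
        (intervalIntegral.integral_nonneg ht.1 fun s _ => sq_nonneg _) ht.1)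
    calc (μ * U t) ^ 2 = μ * (k * U t) ^ 2 := by rw [mul_pow, mul_pow, hk2]; ring
      _ ≤ μ * (t * F) := by gcongr
      _ = μ * F * t := by ring
  -- Young's inequality with the weight `y` that turns the two bounds into a square.
  set y := k * T / Real.sqrt 2 with hy
  have hypos : 0 < y := by positivity
  have hy2 : y ^ 2 = μ * T ^ 2 / 2 := by
    rw [hy, div_pow, Real.sq_sqrt (by norm_num), mul_pow, hk2]
  have hle : ∫ t in (0 : ℝ)..T, p t ^ 2 ≤
      ∫ t in (0 : ℝ)..T, ((1 + y) * (p t + μ * U t) ^ 2 + (1 + 1 / y) * (μ * F) * t) := by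
    refine intervalIntegral.integral_mono_on hT.le
      (Continuous.intervalIntegrable (by fun_prop) _ _)
      (Continuous.intervalIntegrable (by fun_prop) _ _) fun t ht => ?_
    have h1 := hpt t ht
    have h2 : p t ^ 2 ≤ (1 + y) * (p t + μ * U t) ^ 2 + (1 + 1 / y) * (μ * U t) ^ 2 := by
      have h3 : (1 + y) * (p t + μ * U t) ^ 2 + (1 + 1 / y) * (μ * U t) ^ 2 - p t ^ 2 =
          (y * (p t + μ * U t) + μ * U t) ^ 2 / y := by
        field_simp
        ring
      have h4 : 0 ≤ (y * (p t + μ * U t) + μ * U t) ^ 2 / y := by positivity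
      linarith
    have h5 : (1 + 1 / y) * (μ * U t) ^ 2 ≤ (1 + 1 / y) * (μ * F * t) := by gcongr
    linarith
  refine hle.trans (le_of_eq ?_)
  rw [intervalIntegral.integral_add (Continuous.intervalIntegrable (by fun_prop) _ _)
    (Continuous.intervalIntegrable (by fun_prop) _ _), intervalIntegral.integral_const_mul,
    intervalIntegral.integral_const_mul, integral_id, ← hF]
  have : μ * F * (T ^ 2 / 2) = y ^ 2 * F := by rw [hy2]; ring
  rw [show (1 + 1 / y) * (μ * F) * ((T ^ 2 - 0 ^ 2) / 2) = (1 + 1 / y) * (μ * F * (T ^ 2 / 2)) by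
    ring, this]
  field_simp
  ring

/-! ### Weak derivatives of primitives and the bilinear form -/

theorem hasDerivAt_primitive {p : ℝ → ℝ} (hp : Continuous p) (t : ℝ) :
    HasDerivAt (fun x => ∫ s in (0 : ℝ)..x, p s) (p t) t :=
  (hp.integral_hasStrictDerivAt 0 t).hasDerivAt

theorem setIntegral_Ioo_congr_interval {T : ℝ} (hT : 0 ≤ T) {f g : ℝ → ℝ}
    (h : f =ᵐ[volume.restrict (Ioo 0 T)] g) :
    ∫ t in Ioo 0 T, f t = ∫ t in (0 : ℝ)..T, g t := by
  rw [intervalIntegral.integral_of_le hT, integral_Ioc_eq_integral_Ioo]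
  exact integral_congr_ae h

theorem isL2WeakDeriv_of_primitive {T c : ℝ} (hT : 0 < T) {u p : ℝ → ℝ} (hp : Continuous p)
    (hu : ∀ x ∈ Icc 0 T, u x = c + ∫ t in (0 : ℝ)..x, p t) : IsL2WeakDeriv T u p := by
  refine ⟨?_, fun φ h1 h2 h3 => ?_⟩
  · obtain ⟨C, hC⟩ := isCompact_Icc.exists_bound_of_continuousOn (s := Icc 0 T) hp.continuousOn
    exact MemLp.of_bound hp.aestronglyMeasurable C
      ((ae_restrict_mem measurableSet_Ioo).mono fun x hx => hC x (Ioo_subset_Icc_self hx))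
  · have h0 : ∀ x, x ∉ Ioo 0 T → φ x = 0 := fun x hx => by
      by_contra h
      exact hx (h3 (subset_tsupport φ h))
    have hd : Continuous (deriv φ) := h1.continuous_deriv (by simp)
    have hφ : ∀ x, HasDerivAt φ (deriv φ x) x := fun x =>
      (h1.differentiable (by simp)).differentiableAt.hasDerivAt
    have hG : ∀ x, HasDerivAt (fun x => c + ∫ t in (0 : ℝ)..x, p t) (p x) x := fun x =>
      (hasDerivAt_primitive hp x).const_add c
    have hI := intervalIntegral.integral_mul_deriv_eq_deriv_mul (a := 0) (b := T)
      (fun x _ => hG x) (fun x _ => hφ x) (hp.intervalIntegrable _ _) (hd.intervalIntegrable _ _)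
    rw [h0 T (by simp), h0 0 (by simp)] at hI
    rw [setIntegral_Ioo_congr_interval hT.le (g := fun x => (c + ∫ t in (0 : ℝ)..x, p t) * deriv φ x),
      setIntegral_Ioo_congr_interval hT.le (ae_eq_refl _), hI]
    · ring
    · filter_upwards [ae_restrict_mem measurableSet_Ioo] with x hx
      rw [hu x (Ioo_subset_Icc_self hx)]

theorem IsL2WeakDeriv.ae_eq {T : ℝ} {u g k : ℝ → ℝ} (hg : IsL2WeakDeriv T u g)
    (hk : IsL2WeakDeriv T u k) : g =ᵐ[volume.restrict (Ioo 0 T)] k := by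
  have hgi := integrableOn_of_memLp hg.1
  have hki := integrableOn_of_memLp hk.1
  have h := isOpen_Ioo.ae_eq_zero_of_integral_contDiff_smul_eq_zero (μ := volume) (U := Ioo 0 T)
    (f := fun t => g t - k t) (hgi.sub hki).locallyIntegrableOn fun φ h1 h2 h3 => by
      have h0 : ∀ x, x ∉ Ioo 0 T → φ x • (g x - k x) = 0 := fun x hx => by
        have : φ x = 0 := by
          by_contra h
          exact hx (h3 (subset_tsupport φ h))
        simp [this]
      rw [← setIntegral_eq_integral_of_forall_compl_eq_zero h0]
      have he : ∀ x, φ x • (g x - k x) = g x * φ x - k x * φ x := fun x => by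
        rw [smul_eq_mul]
        ring
      simp_rw [he]
      rw [integral_sub (integrableOn_mul_test hgi h1.continuous h2)
        (integrableOn_mul_test hki h1.continuous h2), sub_eq_zero]
      exact neg_injective ((hg.2 φ h1 h2 h3).symm.trans (hk.2 φ h1 h2 h3))
  rw [Filter.EventuallyEq, ae_restrict_iff' measurableSet_Ioo]
  filter_upwards [h] with x hx hxm using sub_eq_zero.1 (hx hxm)

theorem weakDeriv_ae_eq {T c : ℝ} (hT : 0 < T) {u p : ℝ → ℝ} (hp : Continuous p)
    (hu : ∀ x ∈ Icc 0 T, u x = c + ∫ t in (0 : ℝ)..x, p t) :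
    weakDeriv T u =ᵐ[volume.restrict (Ioo 0 T)] p := by
  have h := isL2WeakDeriv_of_primitive hT hp hu
  have hex : ∃ g, IsL2WeakDeriv T u g := ⟨p, h⟩
  rw [weakDeriv, dif_pos hex]
  exact hex.choose_spec.ae_eq h

theorem h1Seminorm_eq {T : ℝ} (hT : 0 < T) {u p : ℝ → ℝ} (hp : Continuous p)
    (hu : ∀ x ∈ Icc 0 T, u x = ∫ t in (0 : ℝ)..x, p t) :
    h1Seminorm T u = Real.sqrt (∫ t in (0 : ℝ)..T, p t ^ 2) := by
  rw [h1Seminorm, setIntegral_Ioo_congr_interval hT.le]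
  filter_upwards [weakDeriv_ae_eq (c := 0) hT hp (by simpa using hu)] with x hx
  rw [hx]

/-- With `p = u'` and `q = v'`, an integration by parts turns `a(u, H̄_T v)` into the
`L²`-product of `q` with `p + μ ∫₀ᵗ u`. -/
theorem bilinForm_HBar_eq {T μ : ℝ} (hT : 0 < T) {u v : H1ZeroLeft T} {p q : ℝ → ℝ}
    (hp : Continuous p) (hq : Continuous q)
    (hu : ∀ x ∈ Icc 0 T, (u : ℝ → ℝ) x = ∫ t in (0 : ℝ)..x, p t)
    (hv : ∀ x ∈ Icc 0 T, (v : ℝ → ℝ) x = ∫ t in (0 : ℝ)..x, q t) :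
    bilinForm T μ u (HBar T v) =
      ∫ t in (0 : ℝ)..T, q t * (p t + μ * ∫ s in (0 : ℝ)..t, ∫ r in (0 : ℝ)..s, p r) := by
  set u₁ : ℝ → ℝ := fun x => ∫ t in (0 : ℝ)..x, p t with hu₁
  set U : ℝ → ℝ := fun x => ∫ t in (0 : ℝ)..x, u₁ t with hU
  have hTT : T ∈ Icc 0 T := ⟨hT.le, le_rfl⟩
  have hu₁d : ∀ t, HasDerivAt u₁ (p t) t := hasDerivAt_primitive hp
  have hu₁c : Continuous u₁ := continuous_iff_continuousAt.2 fun t => (hu₁d t).continuousAt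
  have hUd : ∀ t, HasDerivAt U (u₁ t) t := hasDerivAt_primitive hu₁c
  have hUc : Continuous U := continuous_iff_continuousAt.2 fun t => (hUd t).continuousAt
  set w : ℝ → ℝ := fun x => (v : ℝ → ℝ) T + ∫ t in (0 : ℝ)..x, -q t with hw
  have hwd : ∀ t, HasDerivAt w (-q t) t := fun t =>
    (hasDerivAt_primitive hq.neg t).const_add _
  have hwc : Continuous w := continuous_iff_continuousAt.2 fun t => (hwd t).continuousAt
  have hHB : ∀ x ∈ Icc 0 T, (HBar T v : ℝ → ℝ) x = w x := by
    intro x hx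
    change (v : ℝ → ℝ) T - (v : ℝ → ℝ) x = _
    simp only [hw]
    rw [hv x hx, intervalIntegral.integral_neg, sub_eq_add_neg]
  have hwT : w T = 0 := by
    rw [← hHB T hTT]
    exact sub_self _
  have e1 : ∫ t in Ioo 0 T, weakDeriv T u t * weakDeriv T (HBar T v) t =
      ∫ t in (0 : ℝ)..T, p t * -q t := by
    refine setIntegral_Ioo_congr_interval hT.le ?_
    filter_upwards [weakDeriv_ae_eq (c := 0) hT hp (by simpa using hu),
      weakDeriv_ae_eq hT hq.neg hHB] with x hx hx'
    rw [hx, hx', Pi.neg_apply]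
  have e2 : ∫ t in Ioo 0 T, (u : ℝ → ℝ) t * (HBar T v : ℝ → ℝ) t =
      ∫ t in (0 : ℝ)..T, w t * u₁ t := by
    refine setIntegral_Ioo_congr_interval hT.le ?_
    filter_upwards [ae_restrict_mem measurableSet_Ioo] with x hx
    rw [hu x (Ioo_subset_Icc_self hx), hHB x (Ioo_subset_Icc_self hx), mul_comm]
  have e3 := intervalIntegral.integral_mul_deriv_eq_deriv_mul (a := 0) (b := T)
    (fun t _ => hwd t) (fun t _ => hUd t) (hq.neg.intervalIntegrable _ _)
    (hu₁c.intervalIntegrable _ _)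
  rw [bilinForm, e1, e2, e3, hwT, show U 0 = 0 from intervalIntegral.integral_same]
  change _ = ∫ t in (0 : ℝ)..T, q t * (p t + μ * U t)
  have e4 : ∀ t, q t * (p t + μ * U t) = p t * q t + μ * (q t * U t) := fun t => by ring
  simp_rw [e4]
  rw [intervalIntegral.integral_add (Continuous.intervalIntegrable (by fun_prop) _ _)
    (Continuous.intervalIntegrable (by fun_prop) _ _), intervalIntegral.integral_const_mul]
  simp only [mul_neg, neg_mul, intervalIntegral.integral_neg]
  ring

theorem exists_primitive_of_mem_discreteSpace {T : ℝ} {N : ℕ} {ξ : ℕ → ℝ}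
    (h : IsOpenKnotVector T N ξ) (hT : 0 < T) {u : H1ZeroLeft T} (hu : u ∈ discreteSpace T N ξ) :
    ∃ y : ℕ → ℝ, ∀ x ∈ Icc 0 T, (u : ℝ → ℝ) x = ∫ t in (0 : ℝ)..x, linInterp N ξ y t := by
  obtain ⟨y, c, hy⟩ := exists_primitive_of_mem_splineSpace (u := (u : ℝ → ℝ)) h hT hu
  have h0 : (u : ℝ → ℝ) 0 = 0 := u.2.2
  have hc := hy 0 ⟨le_rfl, hT.le⟩
  rw [h0, intervalIntegral.integral_same, add_zero] at hc
  exact ⟨y, by simpa [← hc] using hy⟩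

theorem exists_mem_discreteSpace_primitive {T : ℝ} {N : ℕ} {ξ : ℕ → ℝ}
    (h : IsOpenKnotVector T N ξ) (hT : 0 < T) (y : ℕ → ℝ) :
    ∃ v ∈ discreteSpace T N ξ,
      ∀ x ∈ Icc 0 T, (v : ℝ → ℝ) x = ∫ t in (0 : ℝ)..x, linInterp N ξ y t := by
  obtain ⟨v, hv, hvx⟩ := exists_mem_splineSpace_primitive h hT y
  have hp := continuous_linInterp N ξ y
  have hc : Continuous fun x => ∫ t in (0 : ℝ)..x, linInterp N ξ y t :=
    continuous_iff_continuousAt.2 fun t => (hasDerivAt_primitive hp t).continuousAt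
  refine ⟨⟨v, ⟨hc.continuousOn.congr hvx, _,
    isL2WeakDeriv_of_primitive (c := 0) hT hp (by simpa using hvx)⟩, ?_⟩, hv, hvx⟩
  have h0 := hvx 0 ⟨le_rfl, hT.le⟩
  rwa [intervalIntegral.integral_same] at h0

/-! ### The discrete inf-sup estimate -/

/-- The error of piecewise linear interpolation of a twice differentiable function in `L²(0,T)`.
Every mesh interval is bounded by the mesh size and by `T`, so its squared length is at most
`h T`. -/
theorem integral_sq_sub_linInterp_le {T : ℝ} {N : ℕ} {ξ : ℕ → ℝ} (h : IsOpenKnotVector T N ξ)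
    (hT : 0 < T) {U u p : ℝ → ℝ} (hU : ∀ t, HasDerivAt U (u t) t)
    (hu : ∀ t, HasDerivAt u (p t) t) (hp : Continuous p) :
    ∫ t in (0 : ℝ)..T, (U t - linInterp N ξ (fun k => U (ξ k)) t) ^ 2 ≤
      (meshSize N ξ * T / 9) ^ 2 * ∫ t in (0 : ℝ)..T, p t ^ 2 := by
  have hN := h.three_le hT
  have hUc : Continuous U := continuous_iff_continuousAt.2 fun t => (hU t).continuousAt
  have hL := continuous_linInterp N ξ fun k => U (ξ k)
  have hsplit : ∀ f : ℝ → ℝ, Continuous f → ∫ t in (0 : ℝ)..T, f t =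
      ∑ k ∈ Finset.Ico 3 (N + 1), ∫ t in ξ k..ξ (k + 1), f t := by
    intro f hf
    rw [intervalIntegral.sum_integral_adjacent_intervals_Ico (by omega)
      fun k _ => hf.intervalIntegrable _ _, h.left_three, h.right_one]
  rw [hsplit _ (by fun_prop), hsplit _ (by fun_prop), Finset.mul_sum]
  refine Finset.sum_le_sum fun k hk => ?_
  rw [Finset.mem_Ico] at hk
  have hlt := h.lt_succ k hk.1 (by omega)
  have hd : 0 < ξ (k + 1) - ξ k := sub_pos.2 hlt
  set s : ℝ := (U (ξ (k + 1)) - U (ξ k)) / (ξ (k + 1) - ξ k) with hs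
  have hlin : ∀ t, HasDerivAt (fun t => U (ξ k) + s * (t - ξ k)) (s * 1) t := fun t =>
    (((hasDerivAt_id' t).sub_const _).const_mul s).const_add _
  have hloc := integral_sq_le_integral_sq_deriv_deriv hlt (p := p)
    (e := fun t => U t - (U (ξ k) + s * (t - ξ k))) (e' := fun t => u t - s * 1)
    (fun t => (hU t).sub (hlin t)) (fun t => (hu t).sub_const _) hp (by simp)
    (by rw [hs]; field_simp; ring)
  have hcongr : ∫ t in ξ k..ξ (k + 1), (U t - linInterp N ξ (fun k => U (ξ k)) t) ^ 2 =
      ∫ t in ξ k..ξ (k + 1), (U t - (U (ξ k) + s * (t - ξ k))) ^ 2 := by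
    refine intervalIntegral.integral_congr fun t ht => ?_
    rw [uIcc_of_le hlt.le] at ht
    rw [linInterp_of_mem h _ hk.1 (by omega) ht, hs]
    congr 2
    field_simp
    ring
  rw [hcongr]
  refine hloc.trans ?_
  have hmesh : ξ (k + 1) - ξ k ≤ meshSize N ξ := (le_abs_self _).trans
    (Finset.le_sup' (fun i => |ξ (i + 1) - ξ i|) (Finset.mem_Icc.2 ⟨by omega, by omega⟩))
  have hkT : ξ (k + 1) - ξ k ≤ T := by
    linarith [h.nonneg (i := k) (by omega) (by omega), h.le_right (i := k + 1) (by omega) (by omega)]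
  have hprod : (ξ (k + 1) - ξ k) ^ 2 ≤ meshSize N ξ * T := by
    rw [sq]
    exact mul_le_mul hmesh hkT hd.le (hd.le.trans hmesh)
  exact mul_le_mul_of_nonneg_right (pow_le_pow_left₀ (by positivity) (by linarith) 2)
    (intervalIntegral.integral_nonneg hlt.le fun t _ => sq_nonneg _)

/-- If `q` is close to `f` in `L²`, then `⟨q, f⟩` is bounded below: this is the polarization
identity for `‖f - q‖²`. -/
theorem integral_sq_add_sq_le {T s E : ℝ} {q f : ℝ → ℝ} (hq : Continuous q)
    (hf : Continuous f) (hE : ∫ t in (0 : ℝ)..T, (f t - q t) ^ 2 ≤ E)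
    (hs : s ^ 2 ≤ (∫ t in (0 : ℝ)..T, f t ^ 2) - E) :
    (∫ t in (0 : ℝ)..T, q t ^ 2) + s ^ 2 ≤ 2 * ∫ t in (0 : ℝ)..T, q t * f t := by
  have h1 : ∀ t, (f t - q t) ^ 2 = f t ^ 2 + q t ^ 2 - 2 * (q t * f t) := fun t => by ring
  simp_rw [h1] at hE
  rw [intervalIntegral.integral_sub (Continuous.intervalIntegrable (by fun_prop) _ _)
      (Continuous.intervalIntegrable (by fun_prop) _ _),
    intervalIntegral.integral_add (Continuous.intervalIntegrable (by fun_prop) _ _)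
      (Continuous.intervalIntegrable (by fun_prop) _ _), intervalIntegral.integral_const_mul] at hE
  linarith

/-- The inf-sup constant, with `x = √μ T`, is at most `1 / (2 + x)`. -/
theorem infSup_const_le {x : ℝ} (hx : 0 ≤ x) :
    2 * Real.pi ^ 2 / ((2 + x) ^ 2 * (Real.pi ^ 2 + 4 * x ^ 2)) ≤ 1 / (2 + x) := by
  have hpi := Real.pi_pos
  rw [div_le_div_iff₀ (by positivity) (by positivity)]
  have h1 : 0 ≤ (2 + x) * (x * Real.pi ^ 2 + (2 + x) * (4 * x ^ 2)) := by positivity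
  nlinarith

/-- The lower bound for `‖f‖² - ε²` needed for the inf-sup estimate, where `f = p + μ U` with
`U'' = p` and `ε = μ h T ‖p‖ / 9`. -/
theorem sq_div_le_sub {T μ η P F : ℝ} (hT : 0 < T) (hμ : 0 < μ) (hη : 0 ≤ η) (hP : 0 ≤ P)
    (hF : P ≤ (1 + Real.sqrt μ * T / Real.sqrt 2) ^ 2 * F)
    (hh : η ≤ Real.pi ^ 2 / (Real.sqrt 2 * (2 + Real.sqrt μ * T) * μ * T)) :
    P / (2 + Real.sqrt μ * T) ^ 2 ≤ F - μ ^ 2 * ((η * T / 9) ^ 2 * P) := by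
  set x := Real.sqrt μ * T with hx
  have hx0 : 0 < x := by positivity
  have h2 : Real.sqrt 2 ^ 2 = 2 := Real.sq_sqrt (by norm_num)
  have h2p : 0 < Real.sqrt 2 := by positivity
  have h21 : 1 ≤ Real.sqrt 2 := Real.one_le_sqrt.2 (by norm_num)
  have hpi : Real.pi ^ 2 ≤ 10 := by nlinarith [Real.pi_lt_d2, Real.pi_pos]
  have hF1 : 2 * P / (2 + x) ^ 2 ≤ F := by
    rw [div_le_iff₀ (by positivity)]
    have e : 2 * (1 + x / Real.sqrt 2) ^ 2 = (Real.sqrt 2 + x) ^ 2 := by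
      field_simp
      rw [h2]
    have hF0 : 0 ≤ F := by
      by_contra! hneg
      have : (1 + x / Real.sqrt 2) ^ 2 * F < 0 := mul_neg_of_pos_of_neg (by positivity) hneg
      linarith
    have h3 : (Real.sqrt 2 + x) ^ 2 ≤ (2 + x) ^ 2 := by
      gcongr
      nlinarith
    calc 2 * P ≤ 2 * (1 + x / Real.sqrt 2) ^ 2 * F := by linarith
      _ = F * (Real.sqrt 2 + x) ^ 2 := by rw [e]; ring
      _ ≤ F * (2 + x) ^ 2 := by gcongr
  have hη1 : (μ * (η * T / 9)) ^ 2 ≤ 1 / (2 + x) ^ 2 := by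
    have h4 : Real.sqrt 2 * (2 + x) * (μ * (η * T)) ≤ 10 := by
      rw [le_div_iff₀ (by positivity)] at hh
      nlinarith
    have h5 : (Real.sqrt 2 * (2 + x) * (μ * (η * T))) ^ 2 ≤ 10 ^ 2 :=
      pow_le_pow_left₀ (by positivity) h4 2
    rw [mul_pow, mul_pow, h2] at h5
    rw [le_div_iff₀ (by positivity)]
    nlinarith
  have e1 : μ ^ 2 * ((η * T / 9) ^ 2 * P) ≤ 1 / (2 + x) ^ 2 * P := by
    rw [← mul_assoc, ← mul_pow]
    gcongr
  have e2 : 2 * P / (2 + x) ^ 2 = P / (2 + x) ^ 2 + 1 / (2 + x) ^ 2 * P := by ring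
  linarith

end IGA

theorem mainTheorem1 (T μ : ℝ) (hT : 0 < T) (hμ : 0 < μ) (N : ℕ) (ξ : ℕ → ℝ)
    (hξ : IGA.IsOpenKnotVector T N ξ)
    (hh : IGA.meshSize N ξ ≤
      Real.pi ^ 2 / (Real.sqrt 2 * (2 + Real.sqrt μ * T) * μ * T)) :
    ∀ u ∈ IGA.discreteSpace T N ξ,
      BddAbove ((fun v : IGA.H1ZeroLeft T =>
          IGA.bilinForm T μ u (IGA.HBar T v) / IGA.h1Seminorm T v) ''
        {v | v ∈ IGA.discreteSpace T N ξ ∧ v ≠ 0}) ∧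
      2 * Real.pi ^ 2 / ((2 + Real.sqrt μ * T) ^ 2 * (Real.pi ^ 2 + 4 * μ * T ^ 2)) *
          IGA.h1Seminorm T u ≤
        sSup ((fun v : IGA.H1ZeroLeft T =>
            IGA.bilinForm T μ u (IGA.HBar T v) / IGA.h1Seminorm T v) ''
          {v | v ∈ IGA.discreteSpace T N ξ ∧ v ≠ 0}) := by
  intro u hu
  obtain ⟨y, hy⟩ := IGA.exists_primitive_of_mem_discreteSpace hξ hT hu
  set p := IGA.linInterp N ξ y with hp_def
  have hp : Continuous p := IGA.continuous_linInterp N ξ y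
  set u₁ : ℝ → ℝ := fun x => ∫ t in (0 : ℝ)..x, p t with hu₁
  set U : ℝ → ℝ := fun x => ∫ t in (0 : ℝ)..x, u₁ t with hU
  have hu₁d : ∀ t, HasDerivAt u₁ (p t) t := IGA.hasDerivAt_primitive hp
  have hu₁c : Continuous u₁ := continuous_iff_continuousAt.2 fun t => (hu₁d t).continuousAt
  have hUd : ∀ t, HasDerivAt U (u₁ t) t := IGA.hasDerivAt_primitive hu₁c
  have hUc : Continuous U := continuous_iff_continuousAt.2 fun t => (hUd t).continuousAt
  set f : ℝ → ℝ := fun t => p t + μ * U t with hf_def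
  have hf : Continuous f := by fun_prop
  have hform : ∀ v : IGA.H1ZeroLeft T, ∀ z : ℕ → ℝ,
      (∀ x ∈ Icc 0 T, (v : ℝ → ℝ) x = ∫ t in (0 : ℝ)..x, IGA.linInterp N ξ z t) →
      IGA.bilinForm T μ u (IGA.HBar T v) = ∫ t in (0 : ℝ)..T, IGA.linInterp N ξ z t * f t :=
    fun v z hz => IGA.bilinForm_HBar_eq hT hp (IGA.continuous_linInterp N ξ z) hy hz
  have hnorm := fun (v : IGA.H1ZeroLeft T) (z : ℕ → ℝ) =>
    IGA.h1Seminorm_eq (u := v) hT (IGA.continuous_linInterp N ξ z)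
  have hbdd : BddAbove ((fun v : IGA.H1ZeroLeft T =>
      IGA.bilinForm T μ u (IGA.HBar T v) / IGA.h1Seminorm T v) ''
      {v | v ∈ IGA.discreteSpace T N ξ ∧ v ≠ 0}) := by
    refine ⟨Real.sqrt (∫ t in (0 : ℝ)..T, f t ^ 2), ?_⟩
    rintro _ ⟨v, ⟨hv, -⟩, rfl⟩
    obtain ⟨z, hz⟩ := IGA.exists_primitive_of_mem_discreteSpace hξ hT hv
    simp only
    rw [hform v z hz, hnorm v z hz]
    refine div_le_of_le_mul₀ (Real.sqrt_nonneg _) (Real.sqrt_nonneg _) ?_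
    rw [mul_comm, ← Real.sqrt_mul (intervalIntegral.integral_nonneg hT.le fun t _ => sq_nonneg _)]
    exact Real.le_sqrt_of_sq_le
      (IGA.sq_integral_mul_le hT.le (IGA.continuous_linInterp N ξ z) hf)
  refine ⟨hbdd, ?_⟩
  -- The test function has as its derivative the interpolant of `f`.
  set z : ℕ → ℝ := y + μ • fun k => U (ξ k) with hz_def
  set q := IGA.linInterp N ξ z with hq_def
  have hq : Continuous q := IGA.continuous_linInterp N ξ z
  obtain ⟨v, hv, hvz⟩ := IGA.exists_mem_discreteSpace_primitive hξ hT z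
  set P := ∫ t in (0 : ℝ)..T, p t ^ 2 with hP_def
  have hP : 0 ≤ P := intervalIntegral.integral_nonneg hT.le fun t _ => sq_nonneg _
  have hη : 0 ≤ IGA.meshSize N ξ := (abs_nonneg _).trans
    (Finset.le_sup' (fun i => |ξ (i + 1) - ξ i|) (Finset.mem_Icc.2 ⟨le_rfl, by omega⟩ : 1 ∈ _))
  have hfq : ∫ t in (0 : ℝ)..T, (f t - q t) ^ 2 ≤
      μ ^ 2 * ((IGA.meshSize N ξ * T / 9) ^ 2 * P) := by
    have e : ∀ t, (f t - q t) ^ 2 =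
        μ ^ 2 * (U t - IGA.linInterp N ξ (fun k => U (ξ k)) t) ^ 2 := fun t => by
      rw [hf_def, hq_def, hz_def, IGA.linInterp_add, IGA.linInterp_smul]
      ring
    simp_rw [e]
    rw [intervalIntegral.integral_const_mul]
    gcongr
    exact IGA.integral_sq_sub_linInterp_le hξ hT hUd hu₁d hp
  have hwave := IGA.integral_sq_le_of_wave hT hμ hUd hu₁d hp
    intervalIntegral.integral_same intervalIntegral.integral_same
  have hlow := IGA.sq_div_le_sub hT hμ hη hP hwave hh
  set x := Real.sqrt μ * T with hx
  have hx0 : 0 < x := mul_pos (Real.sqrt_pos.2 hμ) hT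
  have hx2 : 4 * μ * T ^ 2 = 4 * x ^ 2 := by
    rw [hx, mul_pow, Real.sq_sqrt hμ.le]
    ring
  have hmain := IGA.integral_sq_add_sq_le (s := Real.sqrt P / (2 + x)) hq hf hfq
    (by rwa [div_pow, Real.sq_sqrt hP])
  have hseminorm_u : IGA.h1Seminorm T u = Real.sqrt P := IGA.h1Seminorm_eq hT hp hy
  have hle : 2 * Real.pi ^ 2 / ((2 + x) ^ 2 * (Real.pi ^ 2 + 4 * μ * T ^ 2)) *
      IGA.h1Seminorm T u ≤ Real.sqrt P / (2 + x) := by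
    rw [hx2, hseminorm_u]
    calc _ ≤ 1 / (2 + x) * Real.sqrt P :=
          mul_le_mul_of_nonneg_right (IGA.infSup_const_le hx0.le) (Real.sqrt_nonneg _)
      _ = Real.sqrt P / (2 + x) := by ring
  refine hle.trans ?_
  rcases hP.eq_or_lt with hP0 | hP0
  · -- For `u` of seminorm `0` only the sign matters, and `v` may be replaced by `-v`.
    rw [← hP0, Real.sqrt_zero, zero_div]
    rcases ({v | v ∈ IGA.discreteSpace T N ξ ∧ v ≠ 0} : Set (IGA.H1ZeroLeft T)).eq_empty_or_nonempty
      with hS | ⟨w, hw, hw0⟩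
    · rw [hS, image_empty, Real.sSup_empty]
    · obtain ⟨c, hc⟩ := IGA.exists_primitive_of_mem_discreteSpace hξ hT hw
      have hc' : ∀ x ∈ Icc 0 T, ((-w : IGA.H1ZeroLeft T) : ℝ → ℝ) x =
          ∫ t in (0 : ℝ)..x, IGA.linInterp N ξ ((-1 : ℝ) • c) t := fun x hx => by
        simp_rw [IGA.linInterp_smul]
        rw [intervalIntegral.integral_const_mul, ← hc x hx, neg_one_mul]
        rfl
      rcases le_total 0 (∫ t in (0 : ℝ)..T, IGA.linInterp N ξ c t * f t) with hs | hs
      · refine Real.sSup_nonneg' ⟨_, ⟨w, ⟨hw, hw0⟩, rfl⟩, ?_⟩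
        exact div_nonneg (by rwa [hform w c hc]) (Real.sqrt_nonneg _)
      · refine Real.sSup_nonneg' ⟨_, ⟨-w, ⟨Submodule.neg_mem _ hw, neg_ne_zero.2 hw0⟩, rfl⟩, ?_⟩
        refine div_nonneg ?_ (Real.sqrt_nonneg _)
        rw [hform (-w) _ hc']
        simp_rw [IGA.linInterp_smul, mul_assoc]
        rw [intervalIntegral.integral_const_mul]
        linarith
  · set Q := ∫ t in (0 : ℝ)..T, q t ^ 2 with hQ_def
    have hQ : 0 ≤ Q := intervalIntegral.integral_nonneg hT.le fun t _ => sq_nonneg _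
    have hs : 0 < Real.sqrt P / (2 + x) := by positivity
    have hB : 0 < ∫ t in (0 : ℝ)..T, q t * f t := by nlinarith
    have hQ0 : 0 < Q := by
      refine hQ.lt_of_ne fun h0 => ?_
      have hcs := IGA.sq_integral_mul_le hT.le hq hf
      rw [← hQ_def, ← h0, zero_mul] at hcs
      nlinarith
    have hv0 : v ≠ 0 := by
      rintro rfl
      have e1 := hnorm 0 z hvz
      have e2 : IGA.h1Seminorm T ((0 : IGA.H1ZeroLeft T) : ℝ → ℝ) = 0 := by
        rw [IGA.h1Seminorm_eq (p := fun _ => 0) hT continuous_const (fun x _ => by simp)]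
        simp
      exact (Real.sqrt_pos.2 hQ0).ne (e2.symm.trans e1)
    refine le_csSup_of_le hbdd ⟨v, ⟨hv, hv0⟩, rfl⟩ ?_
    simp only
    rw [hform v z hvz, hnorm v z hvz, le_div_iff₀ (Real.sqrt_pos.2 hQ0)]
    nlinarith [sq_nonneg (Real.sqrt P / (2 + x) - Real.sqrt Q), Real.sq_sqrt hQ]
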